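/- Let $(\mathcal S,\mathcal A,p,r)$ be a Markov decision process with finite state set $\mathcal S$, finite nonempty action set $\mathcal A$, transition probabilities $p(s,a,\cdot)$ on $\mathcal S$ and rewards $r(s,a,s')\in\mathbb R$. Let $e\in\mathcal S$ be a sink state, i.e. $p(e,a,e)=1$ and $r(e,a,e)=0$ for all $a\in\mathcal A$, and assume that the process is transient: for every stationary deterministic policy $\pi\in\Pi:=\mathcal A^{\mathcal S}$ and all $s,s'\in\mathcal S\setminus\{e\}$, $\sum_{t=0}^\infty \mathbb P^{\pi,s}[\tilde s_t=s']<\infty$. For $\beta>0$ let $\operatorname{ERM}_\beta[\tilde x]=-\beta^{-1}\log\mathbb E[e^{-\beta\tilde x}]$. Define, for $s\in\mathcal S$ and $a\in\mathcal A$, $$q^\pi_\beta(s,a)=\lim_{t\to\infty}\operatorname{ERM}_\beta^{\pi,\langle s,a\rangle}\Big[\sum_{k=0}^{t-1}r(\tilde s_k,\tilde a_k,\tilde s_{k+1})\Big]\in[-\infty,\infty],\qquad q^\star_\beta(s,a)=\max_{\pi\in\Pi}q^\pi_\beta(s,a),$$ where $\langle s,a\rangle$ means that $\tilde s_0=s$,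 $\tilde a_0=a$, and $\tilde a_k=\pi(\tilde s_k)$ for $k\ge1$. For $q:\mathcal S\times\mathcal A\to\mathbb R$ define $$(B_\beta q)(s,a)=\operatorname{ERM}_\beta\Big[r(s,a,\tilde s_1)+\max_{a'\in\mathcal A}q(\tilde s_1,a')\Big],\qquad \tilde s_1\sim p(s,a,\cdot).$$ Let $\mathcal B\subseteq\mathbb R_{++}$ be finite and let $\beta\in\mathcal B$. Then the limits defining $q^\pi_\beta$ exist in $[-\infty,\infty]$. If moreover $q^\star_\beta(s,a)>-\infty$ for all $s\in\mathcal S$ and $a\in\mathcal A$, then $q^\star_\beta$ is real-valued, vanishes at the sink ($q^\star_\beta(e,a)=0$ for all $a$), satisfies $q^\star_\beta=B_\beta q^\star_\beta$, and is the only function $q:\mathcal S\times\mathcal A\to\mathbb R$ with $q=B_\beta q$ and $q(e,a)=0$ for all $a\in\mathcal A$. -/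

import Mathlib

open Filter Topology

noncomputable section

/-- A Markov decision process on a finite state space `S` (which contains the sink) and a finite
action space `A`; the sink is absorbing and yields zero reward. -/
structure SinkMDP (S A : Type*) where
  /-- transition probabilities: `p s a s'` is the probability of moving to `s'` -/
  p : S → A → PMF S
  /-- rewards -/
  r : S → A → S → ℝ
  /-- the sink state -/
  sink : S
  p_sink : ∀ a, p sink a sink = 1
  r_sink : ∀ a, r sink a sink = 0

/-- Entropic risk measure `-β⁻¹ log 𝔼[exp (-β X)]` of a random variable on a finite
probability space. -/
def erm {Ω : Type*} [Fintype Ω] (P : PMF Ω) (β : ℝ) (X : Ω → ℝ) : ℝ :=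
  -β⁻¹ * Real.log (∑ ω, (P ω).toReal * Real.exp (-β * X ω))

namespace SinkMDP

variable {S A : Type*}

/-- Law of the trajectory `(s₀, …, s_t)` started at `s₀ = s`, when the action at time `k` is
`d k (s_k)`. -/
def trajectory (M : SinkMDP S A) (d : ℕ → S → A) (s : S) : (t : ℕ) → PMF (Fin (t + 1) → S)
  | 0 => PMF.pure fun _ => s
  | t + 1 => (trajectory M d s t).bind fun ω =>
      (M.p (ω (Fin.last t)) (d t (ω (Fin.last t)))).map fun s' =>
        (Fin.snoc ω s' : Fin (t + 2) → S)

/-- Total reward `∑_{k < t} r(s_k, a_k, s_{k+1})` along a trajectory, with `a_k = d k (s_k)`. -/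
def totalReward (M : SinkMDP S A) (d : ℕ → S → A) (t : ℕ) (ω : Fin (t + 1) → S) : ℝ :=
  ∑ k : Fin t, M.r (ω k.castSucc) (d k (ω k.castSucc)) (ω k.succ)

/-- Every stationary deterministic policy is transient: the expected number of visits to each
non-sink state from each non-sink state is finite. -/
def IsTransient (M : SinkMDP S A) : Prop :=
  ∀ π : S → A, ∀ s s' : S, s ≠ M.sink → s' ≠ M.sink →
    ∑' t : ℕ, ((M.trajectory (fun _ => π) s t).map fun ω => ω (Fin.last t)) s' < ⊤

/-- Decision rules that play `a` at time `0` and follow the stationary policy `π` afterwards. -/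
def firstThen (a : A) (π : S → A) (k : ℕ) (s : S) : A :=
  if k = 0 then a else π s

/-- Horizon-`t` ERM of the total reward when `s₀ = s`, `a₀ = a` and `π` is followed afterwards. -/
def qHorizon [Fintype S] (M : SinkMDP S A) (β : ℝ) (π : S → A) (s : S) (a : A) (t : ℕ) : ℝ :=
  erm (M.trajectory (firstThen a π) s t) β (M.totalReward (firstThen a π) t)

/-- ERM-TRC state-action value function of the policy `π`, a limit in the extended reals. -/
def qPolicy [Fintype S] (M : SinkMDP S A) (β : ℝ) (π : S → A) (s : S) (a : A) : EReal :=
  limUnder atTop fun t : ℕ => ((M.qHorizon β π s a t : ℝ) : EReal)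

/-- Optimal ERM-TRC state-action value function. For finite `S` and finite nonempty `A` the
supremum is over a finite nonempty set of policies, hence a maximum. -/
def qStar [Fintype S] (M : SinkMDP S A) (β : ℝ) (s : S) (a : A) : EReal :=
  ⨆ π : S → A, M.qPolicy β π s a

/-- ERM Bellman operator. -/
def bellman [Fintype S] [Fintype A] [Nonempty A] (M : SinkMDP S A) (β : ℝ)
    (q : S → A → ℝ) (s : S) (a : A) : ℝ :=
  erm (M.p s a) β fun s' =>
    M.r s a s' + Finset.univ.sup' Finset.univ_nonempty fun a' => q s' a'

end SinkMDP

end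

/-! Exponentiating turns ERM into a linear problem: horizon values become iterates of the positive
operator `stepOp`, and maximizing ERM becomes minimizing. Started from the indicator `1_e` of the
sink, the iterates of a policy increase, so they converge or diverge to infinity. The crux is
`IsTransient.tendsto_of_tendsto`. Transience gives `T^N 1_e ≥ δ > 0`, so any terminal `V` with `V e
= 1` differs from `1_e` by at most a multiple of `T^N 1_e - 1_e`; applying `T^t` leaves a difference
of two terms of one convergent sequence. Value iteration from `1_e` is bounded if some policy has
finite value; its limit solves the optimality equation and its greedy policy attains it. Running the
greedy policy of one solution on another compares them (`IsOptimal.le`), hence uniqueness. -/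

noncomputable section

/-! ### Finite expectations -/

namespace PMF

variable {Ω Ω' : Type*} [Fintype Ω] [Fintype Ω']

theorem sum_toReal_bind_mul (P : PMF Ω) (κ : Ω → PMF Ω') (F : Ω' → ℝ) :
    ∑ y, (P.bind κ y).toReal * F y = ∑ x, (P x).toReal * ∑ y, (κ x y).toReal * F y := by
  have h : ∀ y, (P.bind κ y).toReal = ∑ x, (P x).toReal * (κ x y).toReal := fun y => by
    rw [bind_apply, tsum_fintype, ENNReal.toReal_sum fun x _ =>
      ENNReal.mul_ne_top (apply_ne_top _ _) (apply_ne_top _ _)]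
    simp only [ENNReal.toReal_mul]
  simp only [h, Finset.sum_mul, Finset.mul_sum]
  rw [Finset.sum_comm]
  simp only [mul_assoc]

theorem sum_toReal_pure_mul (x : Ω) (F : Ω → ℝ) :
    ∑ y, ((PMF.pure x) y).toReal * F y = F x := by
  classical
  rw [Finset.sum_eq_single x] <;> simp +contextual [pure_apply]

theorem sum_toReal_map_mul (P : PMF Ω) (f : Ω → Ω') (F : Ω' → ℝ) :
    ∑ y, (P.map f y).toReal * F y = ∑ x, (P x).toReal * F (f x) := by
  rw [← bind_pure_comp, sum_toReal_bind_mul]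
  simp only [Function.comp_apply, sum_toReal_pure_mul]

theorem sum_toReal (P : PMF Ω) : ∑ x, (P x).toReal = 1 := by
  rw [← ENNReal.toReal_sum fun x _ => apply_ne_top _ _, ← tsum_fintype (L := .unconditional _),
    P.tsum_coe, ENNReal.toReal_one]

end PMF

/-! ### Exponential weights and positive operators -/

namespace SinkMDP

variable {S A : Type*} (M : SinkMDP S A) (β : ℝ)

/-- Exponentially weighted transition weights. -/
def weight (s : S) (a : A) (s' : S) : ℝ :=
  (M.p s a s').toReal * Real.exp (-β * M.r s a s')

theorem weight_nonneg (s : S) (a : A) (s' : S) : 0 ≤ M.weight β s a s' := by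
  unfold weight; positivity

/-- The indicator function of the sink. -/
def sinkInd : S → ℝ := Set.indicator {M.sink} 1

theorem sinkInd_sink : M.sinkInd M.sink = 1 := by simp [sinkInd]

theorem sinkInd_of_ne {s : S} (h : s ≠ M.sink) : M.sinkInd s = 0 := by simp [sinkInd, h]

theorem sinkInd_nonneg : 0 ≤ M.sinkInd := Set.indicator_nonneg fun _ _ => zero_le_one

theorem sinkInd_le {V : S → ℝ} (h0 : 0 ≤ V) (h1 : V M.sink = 1) : M.sinkInd ≤ V := fun s => by
  by_cases h : s = M.sink
  · rw [h, h1, sinkInd_sink]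
  · rw [M.sinkInd_of_ne h]; exact h0 s

theorem totalReward_snoc (d : ℕ → S → A) (t : ℕ) (ω : Fin (t + 1) → S) (s' : S) :
    M.totalReward d (t + 1) (Fin.snoc ω s' : Fin (t + 2) → S) =
      M.totalReward d t ω + M.r (ω (Fin.last t)) (d t (ω (Fin.last t))) s' := by
  simp only [totalReward, Fin.sum_univ_castSucc (n := t), Fin.succ_last, Fin.snoc_last,
    Fin.snoc_castSucc, Fin.succ_castSucc, Fin.val_castSucc, Fin.val_last]

variable [Fintype S]

/-- The one-step functional `V ↦ 𝔼[exp (-β r(s, a, s₁)) V(s₁)]`. -/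
def stepFun (s : S) (a : A) : (S → ℝ) →ₗ[ℝ] ℝ :=
  ∑ s', M.weight β s a s' • LinearMap.proj s'

/-- The exponential evaluation operator of a stationary policy. -/
def stepOp (π : S → A) : Module.End ℝ (S → ℝ) :=
  LinearMap.pi fun s => M.stepFun β s (π s)

theorem stepFun_apply (s : S) (a : A) (V : S → ℝ) :
    M.stepFun β s a V = ∑ s', M.weight β s a s' * V s' := by
  simp [stepFun]

theorem stepOp_apply (π : S → A) (V : S → ℝ) (s : S) :
    M.stepOp β π V s = M.stepFun β s (π s) V := rfl

theorem stepFun_mono (s : S) (a : A) : Monotone (M.stepFun β s a) := fun V W h => by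
  simp only [stepFun_apply]
  exact Finset.sum_le_sum fun s' _ => mul_le_mul_of_nonneg_left (h s') (M.weight_nonneg β s a s')

theorem stepFun_nonneg (s : S) (a : A) {V : S → ℝ} (hV : 0 ≤ V) : 0 ≤ M.stepFun β s a V := by
  simpa using M.stepFun_mono β s a hV

theorem stepFun_one_pos (s : S) (a : A) : 0 < M.stepFun β s a 1 := by
  obtain ⟨s', hs'⟩ := (M.p s a).support_nonempty
  rw [stepFun_apply]
  refine Finset.sum_pos' (fun s' _ => by simpa using M.weight_nonneg β s a s')
    ⟨s', Finset.mem_univ _, ?_⟩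
  have : 0 < (M.p s a s').toReal := ENNReal.toReal_pos hs' (PMF.apply_ne_top _ _)
  simp only [weight, Pi.one_apply, mul_one]
  positivity

theorem stepFun_pos (s : S) (a : A) {V : S → ℝ} (hV : ∀ s, 0 < V s) :
    0 < M.stepFun β s a V := by
  have : Nonempty S := ⟨s⟩
  obtain ⟨s₀, hs₀⟩ := Finite.exists_min V
  have h : V s₀ • (1 : S → ℝ) ≤ V := fun x => by simpa using hs₀ x
  refine lt_of_lt_of_le ?_ (M.stepFun_mono β s a h)
  rw [map_smul, smul_eq_mul]
  exact mul_pos (hV s₀) (M.stepFun_one_pos β s a)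

theorem stepFun_sink (a : A) (V : S → ℝ) : M.stepFun β M.sink a V = V M.sink := by
  rw [stepFun_apply, Finset.sum_eq_single M.sink]
  · simp [weight, M.p_sink, M.r_sink]
  · intro s' _ h
    have h0 : M.p M.sink a s' = 0 := by
      have := (PMF.apply_eq_one_iff _ _).1 (M.p_sink a)
      rw [PMF.apply_eq_zero_iff, this]
      simpa using h
    simp [weight, h0]
  · simp

theorem stepFun_tendsto (s : S) (a : A) {V : ℕ → S → ℝ} {W : S → ℝ}
    (h : ∀ s, Tendsto (fun t => V t s) atTop (𝓝 (W s))) :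
    Tendsto (fun t => M.stepFun β s a (V t)) atTop (𝓝 (M.stepFun β s a W)) := by
  simp only [stepFun_apply]
  exact tendsto_finsetSum _ fun s' _ => (h s').const_mul _

theorem stepOp_pow_succ (π : S → A) (t : ℕ) (V : S → ℝ) (s : S) :
    (M.stepOp β π ^ (t + 1)) V s = M.stepFun β s (π s) ((M.stepOp β π ^ t) V) := by
  rw [pow_succ']; rfl

theorem stepOp_mono (π : S → A) : Monotone (M.stepOp β π) := fun _ _ h s =>
  M.stepFun_mono β s (π s) h

theorem stepOp_pow_mono (π : S → A) (t : ℕ) :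
    Monotone (M.stepOp β π ^ t : Module.End ℝ (S → ℝ)) := by
  rw [Module.End.coe_pow]
  exact (M.stepOp_mono β π).iterate t

theorem stepOp_pow_sink (π : S → A) (t : ℕ) (V : S → ℝ) :
    (M.stepOp β π ^ t) V M.sink = V M.sink := by
  induction t with
  | zero => simp
  | succ t ih => rw [stepOp_pow_succ, stepFun_sink, ih]

/-- The sink is absorbing with zero reward, so `1_e ≤ T 1_e`; the positive operator `T^t` preserves
this. -/
theorem stepOp_pow_sinkInd_monotone (π : S → A) :
    Monotone fun t => (M.stepOp β π ^ t) M.sinkInd := by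
  refine monotone_nat_of_le_succ fun t => ?_
  rw [pow_succ, Module.End.mul_apply]
  refine M.stepOp_pow_mono β π t (M.sinkInd_le (fun s => M.stepFun_nonneg β s _ M.sinkInd_nonneg) ?_)
  rw [stepOp_apply, stepFun_sink, sinkInd_sink]

/-! ### Trajectories -/

theorem sum_trajectory_zero (d : ℕ → S → A) (s : S) (f : S → ℝ) :
    ∑ ω : Fin (0 + 1) → S, (M.trajectory d s 0 ω).toReal *
      (Real.exp (-β * M.totalReward d 0 ω) * f (ω (Fin.last 0))) = f s := by
  rw [trajectory, PMF.sum_toReal_pure_mul (Ω := Fin 1 → S)]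
  simp [totalReward]

theorem sum_trajectory_succ (d : ℕ → S → A) (s : S) (t : ℕ) (f : S → ℝ) :
    ∑ ω, (M.trajectory d s (t + 1) ω).toReal *
      (Real.exp (-β * M.totalReward d (t + 1) ω) * f (ω (Fin.last (t + 1)))) =
    ∑ ω, (M.trajectory d s t ω).toReal *
      (Real.exp (-β * M.totalReward d t ω) * M.stepOp β (d t) f (ω (Fin.last t))) := by
  rw [trajectory, PMF.sum_toReal_bind_mul]
  refine Finset.sum_congr rfl fun ω _ => ?_
  congr 1
  rw [PMF.sum_toReal_map_mul, stepOp_apply, stepFun_apply, Finset.mul_sum]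
  refine Finset.sum_congr rfl fun s' _ => ?_
  rw [totalReward_snoc, Fin.snoc_last, weight, mul_add, Real.exp_add]
  ring

theorem sum_trajectory_const (π : S → A) (s : S) (t : ℕ) (f : S → ℝ) :
    ∑ ω, (M.trajectory (fun _ => π) s t ω).toReal *
      (Real.exp (-β * M.totalReward (fun _ => π) t ω) * f (ω (Fin.last t))) =
    (M.stepOp β π ^ t) f s := by
  induction t generalizing f with
  | zero => simpa using M.sum_trajectory_zero β (fun _ => π) s f
  | succ t ih => rw [sum_trajectory_succ, ih, pow_succ, Module.End.mul_apply]

theorem sum_trajectory_firstThen (π : S → A) (s : S) (a : A) (t : ℕ) (f : S → ℝ) :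
    ∑ ω, (M.trajectory (firstThen a π) s (t + 1) ω).toReal *
      (Real.exp (-β * M.totalReward (firstThen a π) (t + 1) ω) * f (ω (Fin.last (t + 1)))) =
    M.stepFun β s a ((M.stepOp β π ^ t) f) := by
  induction t generalizing f with
  | zero =>
    rw [sum_trajectory_succ, sum_trajectory_zero, stepOp_apply]
    simp [firstThen]
  | succ t ih =>
    have h : (firstThen a π (t + 1) : S → A) = π := by ext; simp [firstThen]
    rw [sum_trajectory_succ, ih, h, pow_succ, Module.End.mul_apply]

theorem qHorizon_succ (π : S → A) (s : S) (a : A) (t : ℕ) :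
    M.qHorizon β π s a (t + 1) =
      -β⁻¹ * Real.log (M.stepFun β s a ((M.stepOp β π ^ t) 1)) := by
  rw [← sum_trajectory_firstThen, qHorizon, erm]
  simp

/-! ### Transience and reaching the sink -/

variable {M}

theorem IsTransient.tendsto_zero (hM : M.IsTransient) (π : S → A) {s s' : S} (hs : s ≠ M.sink)
    (hs' : s' ≠ M.sink) :
    Tendsto (fun t => (M.stepOp 0 π ^ t) (Set.indicator {s'} 1) s) atTop (𝓝 0) := by
  have h := ENNReal.tendsto_atTop_zero_of_tsum_ne_top (hM π s s' hs hs').ne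
  have h2 := (ENNReal.tendsto_toReal ENNReal.zero_ne_top).comp h
  rw [ENNReal.toReal_zero] at h2
  refine h2.congr fun t => ?_
  rw [← sum_trajectory_const]
  have := PMF.sum_toReal_map_mul (M.trajectory (fun _ => π) s t) (fun ω => ω (Fin.last t))
    (Set.indicator {s'} 1)
  simp only [neg_zero, zero_mul, Real.exp_zero, one_mul, ← this, Function.comp_apply]
  rw [Finset.sum_eq_single s'] <;> simp +contextual

variable (M) in
theorem stepOp_zero_pow_one (π : S → A) (t : ℕ) : (M.stepOp 0 π ^ t) 1 = 1 := by
  induction t with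
  | zero => simp
  | succ t ih =>
    ext s
    rw [stepOp_pow_succ, ih, stepFun_apply]
    simp [weight, PMF.sum_toReal]

/-- At `β = 0` the operator is the transition matrix. The finitely many non-sink probabilities tend
to zero, so the sink's tends to one. -/
theorem IsTransient.exists_pos_zero (hM : M.IsTransient) (π : S → A) (s : S) :
    ∃ t, 0 < (M.stepOp 0 π ^ t) M.sinkInd s := by
  classical
  by_cases hs : s = M.sink
  · exact ⟨0, by simp [hs, sinkInd_sink]⟩
  have hsum : ∀ t, (M.stepOp 0 π ^ t) M.sinkInd s =
      1 - ∑ s' ∈ Finset.univ.erase M.sink, (M.stepOp 0 π ^ t) (Set.indicator {s'} 1) s := by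
    intro t
    have h1 : (1 : S → ℝ) =
        M.sinkInd + ∑ s' ∈ Finset.univ.erase M.sink, Set.indicator {s'} 1 := by
      rw [sinkInd, Finset.add_sum_erase _ (fun s' => Set.indicator {s'} 1) (Finset.mem_univ M.sink)]
      ext x
      simp [Finset.sum_apply]
    have h2 : (M.stepOp 0 π ^ t) (M.sinkInd + ∑ s' ∈ Finset.univ.erase M.sink,
        Set.indicator {s'} 1) s = 1 := by
      rw [← h1, stepOp_zero_pow_one, Pi.one_apply]
    rw [map_add, map_sum, Pi.add_apply, Finset.sum_apply] at h2
    exact eq_sub_of_add_eq h2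
  have hlim : Tendsto (fun t => (M.stepOp 0 π ^ t) M.sinkInd s) atTop (𝓝 (1 - ∑ s' ∈
      Finset.univ.erase M.sink, 0)) := by
    simp only [hsum]
    exact tendsto_const_nhds.sub (tendsto_finsetSum _ fun s' hs' =>
      hM.tendsto_zero π hs (Finset.ne_of_mem_erase hs'))
  rw [Finset.sum_const_zero, sub_zero] at hlim
  exact (hlim.eventually_const_lt one_pos).exists

variable (M) in
-- With `c` the least factor `exp (-β r)`, positivity of reaching the sink passes from `β = 0` to
-- any `β`.
theorem exists_smul_stepOp_zero_le [Finite A] : ∃ c > (0 : ℝ), ∀ (π : S → A) (t : ℕ) (V : S → ℝ), 0 ≤ V →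
    c ^ t • (M.stepOp 0 π ^ t) V ≤ (M.stepOp β π ^ t) V := by
  have : Nonempty S := ⟨M.sink⟩
  cases isEmpty_or_nonempty A
  · exact ⟨1, one_pos, fun π => isEmptyElim (π M.sink)⟩
  obtain ⟨⟨s₀, a₀, s₁⟩, h₀⟩ := Finite.exists_min fun x : S × A × S =>
    Real.exp (-β * M.r x.1 x.2.1 x.2.2)
  refine ⟨Real.exp (-β * M.r s₀ a₀ s₁), Real.exp_pos _, fun π t V hV => ?_⟩
  set c := Real.exp (-β * M.r s₀ a₀ s₁)
  have hstep : ∀ W : S → ℝ, 0 ≤ W → c • M.stepOp 0 π W ≤ M.stepOp β π W := fun W hW s => by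
    simp only [Pi.smul_apply, stepOp_apply, stepFun_apply, smul_eq_mul, Finset.mul_sum, weight]
    refine Finset.sum_le_sum fun s' _ => ?_
    have h1 := mul_le_mul_of_nonneg_right (h₀ (s, π s, s'))
      (mul_nonneg (ENNReal.toReal_nonneg (a := M.p s (π s) s')) (hW s'))
    simp only [neg_zero, zero_mul, Real.exp_zero, mul_one]
    linarith
  induction t with
  | zero => simp
  | succ t ih =>
    rw [pow_succ' (M.stepOp β π), Module.End.mul_apply]
    refine le_trans ?_ (M.stepOp_mono β π ih)
    rw [pow_succ', pow_succ', mul_comm, mul_smul, map_smul, Module.End.mul_apply]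
    refine smul_le_smul_of_nonneg_left (hstep _ ?_) (pow_nonneg (Real.exp_pos _).le _)
    simpa using M.stepOp_pow_mono 0 π t hV

theorem IsTransient.exists_le [Finite A] (hM : M.IsTransient) (π : S → A) :
    ∃ N, ∃ δ > 0, ∀ s, δ ≤ (M.stepOp β π ^ N) M.sinkInd s := by
  have : Nonempty S := ⟨M.sink⟩
  obtain ⟨c, hc, hle⟩ := M.exists_smul_stepOp_zero_le β
  choose n hn using hM.exists_pos_zero π
  -- Monotonicity in time lets one `N` serve all states.
  obtain ⟨N, hN⟩ := (Set.finite_range n).bddAbove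
  have hpos : ∀ s, 0 < (M.stepOp β π ^ N) M.sinkInd s := fun s =>
    (mul_pos (pow_pos hc (n s)) (hn s)).trans_le <| (hle π (n s) _ M.sinkInd_nonneg s).trans
      (M.stepOp_pow_sinkInd_monotone β π (hN ⟨s, rfl⟩) s)
  obtain ⟨s₀, hs₀⟩ := Finite.exists_min ((M.stepOp β π ^ N) M.sinkInd)
  exact ⟨N, _, hpos s₀, hs₀⟩

/-- Along a fixed policy, the terminal condition does not influence a finite limit. -/
theorem IsTransient.tendsto_of_tendsto [Finite A] (hM : M.IsTransient) (π : S → A) (s : S) (a : A)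
    {l : ℝ} (hl : Tendsto (fun t => M.stepFun β s a ((M.stepOp β π ^ t) M.sinkInd)) atTop (𝓝 l))
    {V : S → ℝ} (hV : V M.sink = 1) :
    Tendsto (fun t => M.stepFun β s a ((M.stepOp β π ^ t) V)) atTop (𝓝 l) := by
  have : Nonempty S := ⟨M.sink⟩
  obtain ⟨N, δ, hδ, hN⟩ := hM.exists_le β π
  obtain ⟨s₀, hs₀⟩ := Finite.exists_max fun s => |V s|
  set K := |V s₀| / δ with hK
  -- `X` vanishes at the sink and is at least `δ` elsewhere, so `K • X` dominates `|V - 1_e|`.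
  set X := (M.stepOp β π ^ N) M.sinkInd - M.sinkInd with hX
  have hVX : V - M.sinkInd ≤ K • X ∧ -(K • X) ≤ V - M.sinkInd := by
    refine forall_and.1 fun x => abs_le'.trans (by simp [neg_le]) |>.1 (?_ : |V x - M.sinkInd x| ≤ K * X x)
    by_cases hx : x = M.sink
    · simp [hx, hV, X, sinkInd_sink, stepOp_pow_sink]
    · have h1 : X x = (M.stepOp β π ^ N) M.sinkInd x := by simp [X, M.sinkInd_of_ne hx]
      rw [M.sinkInd_of_ne hx, sub_zero, h1]
      calc |V x| ≤ |V s₀| := hs₀ x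
        _ = K * δ := by rw [hK]; field_simp
        _ ≤ _ := mul_le_mul_of_nonneg_left (hN x) (by positivity)
  set F : ℕ → (S → ℝ) →ₗ[ℝ] ℝ := fun t => (M.stepFun β s a).comp (M.stepOp β π ^ t) with hF
  have hmono : ∀ t, Monotone (F t) := fun t =>
    (M.stepFun_mono β s a).comp (M.stepOp_pow_mono β π t)
  have hFX : ∀ t, F t X = F (t + N) M.sinkInd - F t M.sinkInd := fun t => by
    simp [hX, hF, pow_add]
  have hl' : Tendsto (fun t => F t M.sinkInd) atTop (𝓝 l) := hl
  have h0 : Tendsto (fun t => F t X) atTop (𝓝 0) := by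
    simp only [hFX]
    simpa using (hl'.comp (tendsto_add_atTop_nat N)).sub hl'
  have h1 : Tendsto (fun t => F t (V - M.sinkInd)) atTop (𝓝 0) := by
    refine tendsto_of_tendsto_of_tendsto_of_le_of_le (g := fun t => F t (-(K • X)))
      (h := fun t => F t (K • X)) ?_ ?_ (fun t => hmono t hVX.2) (fun t => hmono t hVX.1)
    · simpa using (h0.const_mul K).neg
    · simpa using h0.const_mul K
  have h2 := h1.add hl'
  simpa [hF] using h2

/-! ### Limits of horizon values -/

theorem IsTransient.tendsto_qHorizon [Finite A] (hM : M.IsTransient) (π : S → A) (s : S) (a : A)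
    {l : ℝ} (hl : Tendsto (fun t => M.stepFun β s a ((M.stepOp β π ^ t) M.sinkInd)) atTop (𝓝 l)) :
    Tendsto (fun t => ((M.qHorizon β π s a t : ℝ) : EReal)) atTop
      (𝓝 ((-β⁻¹ * Real.log l : ℝ) : EReal)) := by
  obtain ⟨N, δ, hδ, hN⟩ := hM.exists_le β π
  have hmono : Monotone fun t => M.stepFun β s a ((M.stepOp β π ^ t) M.sinkInd) :=
    (M.stepFun_mono β s a).comp (M.stepOp_pow_sinkInd_monotone β π)
  have hlpos : 0 < l := (M.stepFun_pos β s a fun s => hδ.trans_le (hN s)).trans_le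
    (hmono.ge_of_tendsto hl N)
  refine (continuous_coe_real_ereal.tendsto _).comp ((tendsto_add_atTop_iff_nat 1).1 ?_)
  simp only [qHorizon_succ]
  -- The horizon value has terminal condition `1` instead of `1_e`.
  exact ((hM.tendsto_of_tendsto β π s a hl rfl).log hlpos.ne').const_mul _

variable (M) in
theorem tendsto_qHorizon_bot (hβ : 0 < β) (π : S → A) (s : S) (a : A)
    (h : Tendsto (fun t => M.stepFun β s a ((M.stepOp β π ^ t) M.sinkInd)) atTop atTop) :
    Tendsto (fun t => ((M.qHorizon β π s a t : ℝ) : EReal)) atTop (𝓝 ⊥) := by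
  refine EReal.tendsto_coe_nhds_bot_iff.2 ((tendsto_add_atTop_iff_nat 1).1 ?_)
  simp only [qHorizon_succ]
  refine (Real.tendsto_log_atTop.comp (tendsto_atTop_mono (fun t => ?_) h)).const_mul_atTop_of_neg
    (neg_lt_zero.2 (inv_pos.2 hβ))
  exact M.stepFun_mono β s a (M.stepOp_pow_mono β π t (M.sinkInd_le zero_le_one rfl))

theorem IsTransient.exists_tendsto_qHorizon [Finite A] (hM : M.IsTransient) (hβ : 0 < β)
    (π : S → A) (s : S) (a : A) :
    (M.qPolicy β π s a = ⊥ ∨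
      ∃ l, Tendsto (fun t => M.stepFun β s a ((M.stepOp β π ^ t) M.sinkInd)) atTop (𝓝 l) ∧
        M.qPolicy β π s a = ((-β⁻¹ * Real.log l : ℝ) : EReal)) ∧
    Tendsto (fun t => ((M.qHorizon β π s a t : ℝ) : EReal)) atTop (𝓝 (M.qPolicy β π s a)) := by
  have hmono : Monotone fun t => M.stepFun β s a ((M.stepOp β π ^ t) M.sinkInd) :=
    (M.stepFun_mono β s a).comp (M.stepOp_pow_sinkInd_monotone β π)
  rcases tendsto_atTop_of_monotone hmono with h | ⟨l, hl⟩
  · have := M.tendsto_qHorizon_bot β hβ π s a h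
    rw [qPolicy, this.limUnder_eq]
    exact ⟨.inl rfl, this⟩
  · have := hM.tendsto_qHorizon β π s a hl
    rw [qPolicy, this.limUnder_eq]
    exact ⟨.inr ⟨l, hl, rfl⟩, this⟩

/-- The exponential form of the Bellman optimality equation. -/
def IsOptimal (M : SinkMDP S A) (β : ℝ) (V : S → ℝ) : Prop :=
  (∀ s a, V s ≤ M.stepFun β s a V) ∧ ∃ π : S → A, ∀ s, V s = M.stepFun β s (π s) V

/-! ### Fixed points and comparison -/

variable (M) in
theorem stepOp_pow_eq_self {π : S → A} {V : S → ℝ} (h : ∀ s, V s = M.stepFun β s (π s) V) (t : ℕ) :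
    (M.stepOp β π ^ t) V = V := by
  induction t with
  | zero => rfl
  | succ t ih => ext s; rw [stepOp_pow_succ, ih, ← h s]

variable (M) in
theorem le_stepOp_pow {π : S → A} {V : S → ℝ} (h : ∀ s, V s ≤ M.stepFun β s (π s) V) (t : ℕ) :
    V ≤ (M.stepOp β π ^ t) V := by
  induction t with
  | zero => rfl
  | succ t ih =>
    intro s
    rw [stepOp_pow_succ]
    exact (h s).trans (M.stepFun_mono β s _ ih)

variable (M) in
theorem stepOp_pow_sinkInd_le {π : S → A} {V : S → ℝ} (h : ∀ s, V s = M.stepFun β s (π s) V)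
    (h0 : 0 ≤ V) (h1 : V M.sink = 1) (t : ℕ) : (M.stepOp β π ^ t) M.sinkInd ≤ V :=
  (M.stepOp_pow_mono β π t (M.sinkInd_le h0 h1)).trans (M.stepOp_pow_eq_self β h t).le

/-- The iterates stay below the fixed point `V`, so they converge; with terminal condition `V` they
are constant, which identifies the limit. -/
theorem IsTransient.tendsto_greedy [Finite A] (hM : M.IsTransient) {π : S → A} {V : S → ℝ}
    (h : ∀ s, V s = M.stepFun β s (π s) V) (h0 : 0 ≤ V) (h1 : V M.sink = 1) (s : S) (a : A) :
    Tendsto (fun t => M.stepFun β s a ((M.stepOp β π ^ t) M.sinkInd)) atTop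
      (𝓝 (M.stepFun β s a V)) := by
  have hmono : Monotone fun t => M.stepFun β s a ((M.stepOp β π ^ t) M.sinkInd) :=
    (M.stepFun_mono β s a).comp (M.stepOp_pow_sinkInd_monotone β π)
  rcases tendsto_atTop_of_monotone hmono with h' | ⟨l, hl⟩
  · refine absurd (h'.eventually_gt_atTop (M.stepFun β s a V)) fun hev => ?_
    obtain ⟨t, ht⟩ := hev.exists
    exact ht.not_ge (M.stepFun_mono β s a (M.stepOp_pow_sinkInd_le β h h0 h1 t))
  · have h2 := hM.tendsto_of_tendsto β π s a hl h1
    simp only [M.stepOp_pow_eq_self β h] at h2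
    rwa [tendsto_nhds_unique tendsto_const_nhds h2]

/-- For `π` greedy for `W`, `V ≤ T_π^t V`, and the right side tends to `W`. -/
theorem IsOptimal.le [Finite A] {V W : S → ℝ} (hV : IsOptimal M β V) (hW : IsOptimal M β W)
    (hM : M.IsTransient) (hV1 : V M.sink = 1) (hW0 : 0 ≤ W) (hW1 : W M.sink = 1) : V ≤ W := by
  obtain ⟨π, hπ⟩ := hW.2
  intro s
  have h1 := hM.tendsto_of_tendsto β π s (π s) (hM.tendsto_greedy β hπ hW0 hW1 s (π s)) hV1
  rw [← hπ s] at h1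
  refine ge_of_tendsto' h1 fun t => ?_
  rw [← stepOp_pow_succ]
  exact M.le_stepOp_pow β (fun s => hV.1 s (π s)) (t + 1) s

/-! ### Value iteration and the Bellman equation -/

section Optimality

variable [Fintype A] [Nonempty A]

/-- Optimal value iterates in exponential form, started from the indicator of the sink. -/
def valueIter (M : SinkMDP S A) (β : ℝ) : ℕ → S → ℝ
  | 0 => M.sinkInd
  | t + 1 => fun s => Finset.univ.inf' Finset.univ_nonempty fun a =>
      M.stepFun β s a (valueIter M β t)

variable (M)

theorem valueIter_succ_le (t : ℕ) (s : S) (a : A) :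
    M.valueIter β (t + 1) s ≤ M.stepFun β s a (M.valueIter β t) :=
  Finset.inf'_le _ (Finset.mem_univ a)

theorem valueIter_sink (t : ℕ) : M.valueIter β t M.sink = 1 := by
  induction t with
  | zero => exact M.sinkInd_sink
  | succ t ih => simp [valueIter, stepFun_sink, ih]

theorem valueIter_monotone : Monotone (M.valueIter β) := by
  refine monotone_nat_of_le_succ fun t => ?_
  induction t with
  | zero =>
    refine M.sinkInd_le (fun s => ?_) (M.valueIter_sink β 1)
    exact Finset.le_inf' Finset.univ_nonempty _ fun a _ => M.stepFun_nonneg β s a M.sinkInd_nonneg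
  | succ t ih =>
    exact fun s => Finset.le_inf' Finset.univ_nonempty _ fun a _ =>
      (M.valueIter_succ_le β t s a).trans (M.stepFun_mono β s a ih)

theorem valueIter_le (π : S → A) (t : ℕ) : M.valueIter β t ≤ (M.stepOp β π ^ t) M.sinkInd := by
  induction t with
  | zero => rfl
  | succ t ih =>
    intro s
    rw [stepOp_pow_succ]
    exact (M.valueIter_succ_le β t s (π s)).trans (M.stepFun_mono β s _ ih)

/-- A minimum over finitely many actions is continuous, so the recursion passes to the limit. -/
theorem exists_isOptimal (h : ∀ s, BddAbove (Set.range fun t => M.valueIter β t s)) :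
    ∃ V, IsOptimal M β V ∧ ∀ s, Tendsto (fun t => M.valueIter β t s) atTop (𝓝 (V s)) := by
  have hlim : ∀ s, Tendsto (fun t => M.valueIter β t s) atTop (𝓝 (⨆ t, M.valueIter β t s)) :=
    fun s => tendsto_atTop_ciSup (fun _ _ hij => M.valueIter_monotone β hij s) (h s)
  set V : S → ℝ := fun s => ⨆ t, M.valueIter β t s
  have heq : ∀ s, V s = Finset.univ.inf' Finset.univ_nonempty fun a => M.stepFun β s a V :=
    fun s => by
      have h1 : Tendsto (fun t => M.valueIter β (t + 1) s) atTop
          (𝓝 (Finset.univ.inf' Finset.univ_nonempty fun a => M.stepFun β s a V)) :=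
        Filter.Tendsto.finset_inf'_nhds_apply Finset.univ_nonempty
          fun a _ => M.stepFun_tendsto β s a hlim
      exact tendsto_nhds_unique ((tendsto_add_atTop_iff_nat 1).2 (hlim s)) h1
  refine ⟨V, ⟨fun s a => ?_, ?_⟩, hlim⟩
  · rw [heq s]
    exact Finset.inf'_le _ (Finset.mem_univ a)
  · have : ∀ s, ∃ a, V s = M.stepFun β s a V := fun s => by
      obtain ⟨a, -, ha⟩ := Finset.exists_mem_eq_inf' Finset.univ_nonempty
        fun a => M.stepFun β s a V
      exact ⟨a, (heq s).trans ha⟩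
    exact ⟨_, fun s => (this s).choose_spec⟩

theorem bellman_eq (q : S → A → ℝ) (s : S) (a : A) :
    M.bellman β q s a = -β⁻¹ * Real.log (M.stepFun β s a fun s' =>
      Real.exp (-β * Finset.univ.sup' Finset.univ_nonempty fun a' => q s' a')) := by
  simp only [bellman, erm, stepFun_apply, weight, mul_add, Real.exp_add, mul_assoc]

variable {M β}

theorem exp_neg_mul_neg_inv_mul_log (hβ : 0 < β) {x : ℝ} (hx : 0 < x) :
    Real.exp (-β * (-β⁻¹ * Real.log x)) = x := by
  rw [← mul_assoc, neg_mul_neg, mul_inv_cancel₀ hβ.ne', one_mul, Real.exp_log hx]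

theorem neg_inv_mul_log_le (hβ : 0 < β) {x y : ℝ} (hx : 0 < x) (h : x ≤ y) :
    -β⁻¹ * Real.log y ≤ -β⁻¹ * Real.log x :=
  mul_le_mul_of_nonpos_left (Real.log_le_log hx h) (neg_nonpos.2 (inv_pos.2 hβ).le)

theorem IsOptimal.eq_bellman (hβ : 0 < β) {V : S → ℝ} (hV : IsOptimal M β V)
    (hpos : ∀ s, 0 < V s) :
    (fun s a => -β⁻¹ * Real.log (M.stepFun β s a V)) =
      M.bellman β fun s a => -β⁻¹ * Real.log (M.stepFun β s a V) := by
  obtain ⟨π, hπ⟩ := hV.2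
  have hmax : ∀ s, (Finset.univ.sup' Finset.univ_nonempty fun a =>
      -β⁻¹ * Real.log (M.stepFun β s a V)) = -β⁻¹ * Real.log (V s) := fun s => by
    refine le_antisymm (Finset.sup'_le _ _ fun a _ =>
      neg_inv_mul_log_le hβ (hpos s) (hV.1 s a)) ?_
    conv_lhs => rw [hπ s]
    exact Finset.le_sup' (fun a => -β⁻¹ * Real.log (M.stepFun β s a V)) (Finset.mem_univ (π s))
  ext s a
  simp only [bellman_eq, hmax, exp_neg_mul_neg_inv_mul_log hβ (hpos _)]

theorem isOptimal_of_eq_bellman (hβ : 0 < β) {q : S → A → ℝ} (hq : q = M.bellman β q) :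
    IsOptimal M β fun s =>
      Real.exp (-β * Finset.univ.sup' Finset.univ_nonempty fun a => q s a) := by
  set V : S → ℝ := fun s =>
    Real.exp (-β * Finset.univ.sup' Finset.univ_nonempty fun a => q s a) with hV
  have hstep : ∀ s a, M.stepFun β s a V = Real.exp (-β * q s a) := fun s a => by
    have h := M.bellman_eq β q s a
    rw [← hq] at h
    rw [h, exp_neg_mul_neg_inv_mul_log hβ (M.stepFun_pos β s a fun s => Real.exp_pos _)]
  refine ⟨fun s a => ?_, ?_⟩
  · rw [hstep]
    exact Real.exp_le_exp.2 (mul_le_mul_of_nonpos_left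
      (Finset.le_sup' (fun a => q s a) (Finset.mem_univ a)) (neg_nonpos.2 hβ.le))
  · choose π _ hπ using fun s =>
      Finset.exists_mem_eq_sup' (Finset.univ_nonempty (α := A)) fun a => q s a
    exact ⟨π, fun s => by rw [hstep, hV]; simp only [hπ s]⟩

theorem IsTransient.exists_isOptimal_qStar (hM : M.IsTransient) (hβ : 0 < β)
    (h : ∀ s a, ⊥ < M.qStar β s a) :
    ∃ V : S → ℝ, IsOptimal M β V ∧ (∀ s, 0 < V s) ∧ V M.sink = 1 ∧
      ∀ s a, ((-β⁻¹ * Real.log (M.stepFun β s a V) : ℝ) : EReal) = M.qStar β s a := by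
  have hbdd : ∀ s, BddAbove (Set.range fun t => M.valueIter β t s) := by
    intro s
    obtain ⟨a⟩ := ‹Nonempty A›
    obtain ⟨π, hπ⟩ := lt_iSup_iff.1 (h s a)
    rcases (hM.exists_tendsto_qHorizon β hβ π s a).1 with h' | ⟨l, hl, -⟩
    · exact absurd h' hπ.ne'
    · have hmono : Monotone fun t => M.stepFun β s a ((M.stepOp β π ^ t) M.sinkInd) :=
        (M.stepFun_mono β s a).comp (M.stepOp_pow_sinkInd_monotone β π)
      refine ⟨l, ?_⟩
      rintro _ ⟨t, rfl⟩
      exact (M.valueIter_monotone β t.le_succ s).trans <| (M.valueIter_succ_le β t s a).trans <|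
        (M.stepFun_mono β s a (M.valueIter_le β π t)).trans (hmono.ge_of_tendsto hl t)
  obtain ⟨V, hV, hlim⟩ := M.exists_isOptimal β hbdd
  have hle : ∀ t, M.valueIter β t ≤ V := fun t s =>
    Monotone.ge_of_tendsto (fun _ _ hij => M.valueIter_monotone β hij s) (hlim s) t
  have h0 : 0 ≤ V := M.sinkInd_nonneg.trans (hle 0)
  have h1 : V M.sink = 1 := by
    refine tendsto_nhds_unique (hlim M.sink) ?_
    simp only [valueIter_sink]
    exact tendsto_const_nhds
  obtain ⟨π, hπ⟩ := hV.2
  obtain ⟨N, δ, hδ, hN⟩ := hM.exists_le β π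
  have hpos : ∀ s, 0 < V s := fun s =>
    (hδ.trans_le (hN s)).trans_le (M.stepOp_pow_sinkInd_le β hπ h0 h1 N s)
  refine ⟨V, hV, hpos, h1, fun s a => le_antisymm ?_ (iSup_le fun π' => ?_)⟩
  -- The greedy policy attains the value.
  · refine le_trans (le_of_eq ?_) (le_iSup _ π)
    exact (hM.tendsto_qHorizon β π s a (hM.tendsto_greedy β hπ h0 h1 s a)).limUnder_eq.symm
  · rcases (hM.exists_tendsto_qHorizon β hβ π' s a).1 with h' | ⟨l, hl, h'⟩
    · rw [h']; exact bot_le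
    · rw [h', EReal.coe_le_coe_iff]
      -- Value iterates lie below those of `π'`; the order persists in the limit and `-β⁻¹ log`
      -- reverses it.
      exact neg_inv_mul_log_le hβ (M.stepFun_pos β s a hpos) (le_of_tendsto_of_tendsto'
        (M.stepFun_tendsto β s a hlim) hl fun t => M.stepFun_mono β s a (M.valueIter_le β π' t))

end Optimality

end SinkMDP

end

theorem mainTheorem3 {S A : Type*} [Fintype S] [Fintype A] [Nonempty A]
    (M : SinkMDP S A) (hM : M.IsTransient)
    (B : Finset ℝ) (hB : ∀ b ∈ B, 0 < b) (β : ℝ) (hβ : β ∈ B) :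
    (∀ (π : S → A) (s : S) (a : A),
      Tendsto (fun t : ℕ => ((M.qHorizon β π s a t : ℝ) : EReal)) atTop
        (𝓝 (M.qPolicy β π s a))) ∧
    ((∀ (s : S) (a : A), ⊥ < M.qStar β s a) →
      ∃ q : S → A → ℝ,
        (∀ (s : S) (a : A), ((q s a : ℝ) : EReal) = M.qStar β s a) ∧
        q = M.bellman β q ∧
        (∀ a : A, q M.sink a = 0) ∧
        ∀ q' : S → A → ℝ, q' = M.bellman β q' → (∀ a : A, q' M.sink a = 0) → q' = q) := by
  have hβ0 := hB β hβ
  refine ⟨fun π s a => (hM.exists_tendsto_qHorizon β hβ0 π s a).2, fun h => ?_⟩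
  obtain ⟨V, hV, hpos, h1, hq⟩ := hM.exists_isOptimal_qStar hβ0 h
  refine ⟨_, hq, hV.eq_bellman hβ0 hpos, fun a => ?_, fun q' hq' h0 => ?_⟩
  · rw [SinkMDP.stepFun_sink, h1, Real.log_one, mul_zero]
  · have hV' := SinkMDP.isOptimal_of_eq_bellman hβ0 hq'
    have h1' : Real.exp (-β * Finset.univ.sup' Finset.univ_nonempty fun a => q' M.sink a) = 1 := by
      simp [h0]
    have hVV := le_antisymm
      (hV'.le β hV hM h1' (fun s => (hpos s).le) h1)
      (hV.le β hV' hM h1 (fun s => (Real.exp_pos _).le) h1')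
    ext s a
    -- A Bellman fixed point is recovered from its exponential state values.
    rw [hq', SinkMDP.bellman_eq, hVV]
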